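/- Let $P\subset\mathbb{R}^2$ be a closed convex $n$-gon ($n\ge 3$, no flat vertices), and let $G\subset P$ be a finite set of points, called guards. Two distinct guards $a,b$ are visible to one another if no guard lies strictly between them on the segment $ab$; in that case $b$ generates a dark ray at $a$, namely the ray $\{a+t(a-b): t>0\}$, which is open at its root $a$. A point is $2$-dark if it lies in at least two dark rays. Let $C$ be the convex hull of $G$. Suppose that no point of $P$ is $2$-dark, and that $P$ maximally touches $C$ in the sense that every edge of $P$ has at least one guard in its relative interior, or has guards at both of its endpoints. Let $g^P$ be the number of guards on $\partial P$, let $c$ be the number of guards in the interior of $P$ that are corners (extreme points) of $C$, and let $g^*=g^P+c$. Call a vertex $v$ of $P$ darkened if there are two guards $a,b$, both on $\partial P$, such that $b$ generates a dark ray at $a$ that contains $v$; let $d$ be the number of darkened vertices. Then $$g^*\le 2n,\qquad\text{and moreover}\qquad g^P=n+\tfrac12 d,\qquad c\le n-d .$$ -/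

import Mathlib

namespace DarkRays

/-- The Euclidean plane. -/
abbrev Plane : Type := EuclideanSpace ℝ (Fin 2)

/-- Twice the signed area of the triangle `a b c`; it is positive exactly when `c` lies strictly
to the left of the directed line from `a` to `b`. -/
def cross (a b c : Plane) : ℝ :=
  (b 0 - a 0) * (c 1 - a 1) - (b 1 - a 1) * (c 0 - a 0)

/-- `P` is a (nondegenerate) convex `n`-gon whose vertices are listed in counterclockwise order:
there are at least three vertices, and every vertex that is not an endpoint of a given edge lies
strictly to the left of that edge. In particular no vertex is flat. -/
def IsConvexPolygon {n : ℕ} (P : Polygon Plane n) : Prop :=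
  3 ≤ n ∧ ∀ i j : Fin n, j ≠ i → j ≠ finRotate n i → 0 < cross (P i) (P (finRotate n i)) (P j)

/-- The closed region bounded by a convex polygon. Its boundary is Mathlib's `P.boundary ℝ`, the
union of the closed edges. -/
def region {n : ℕ} (P : Polygon Plane n) : Set Plane :=
  convexHull ℝ (Set.range P.vertices)

/-- The guards `a` and `b` see each other (in a convex polygon): they are distinct and no guard
lies strictly between them. -/
def MutuallyVisible (G : Finset Plane) (a b : Plane) : Prop :=
  a ∈ G ∧ b ∈ G ∧ a ≠ b ∧ ∀ h ∈ G, ¬ Sbtw ℝ a h b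

/-- The ray at `a` generated by `b`: all points `x` such that `a` lies strictly between
`b` and `x`. It is open at its root `a`. -/
def rayBehind (a b : Plane) : Set Plane :=
  {x | Sbtw ℝ b a x}

/-- The dark rays of a set of guards: the rays at a guard `a` generated by a guard `b`, where
`a` and `b` are visible to one another. -/
def darkRays (G : Finset Plane) : Set (Set Plane) :=
  {R | ∃ a b : Plane, MutuallyVisible G a b ∧ R = rayBehind a b}

/-- `x` is `m`-dark: it is contained in at least `m` dark rays. -/
def IsDark (m : ℕ) (G : Finset Plane) (x : Plane) : Prop :=
  (m : ℕ∞) ≤ {R | R ∈ darkRays G ∧ x ∈ R}.encard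

/-- The polygon maximally touches the guards: every edge has a guard in its relative interior,
or guards at both of its endpoints. -/
def IsShrunken {n : ℕ} (P : Polygon Plane n) (G : Finset Plane) : Prop :=
  ∀ i : Fin n, (∃ g ∈ G, Sbtw ℝ (P i) g (P (finRotate n i))) ∨
    (P i ∈ G ∧ P (finRotate n i) ∈ G)

/-- The guards on `∂P`. -/
def boundaryGuards {n : ℕ} (P : Polygon Plane n) (G : Finset Plane) : Set Plane :=
  {g | g ∈ G ∧ g ∈ P.boundary ℝ}

/-- The guards in the interior of `P` that are corners (extreme points) of the convex hull of
the guards. -/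
def interiorCorners {n : ℕ} (P : Polygon Plane n) (G : Finset Plane) : Set Plane :=
  {g | g ∈ G ∧ g ∈ (convexHull ℝ (G : Set Plane)).extremePoints ℝ ∧ g ∈ interior (region P)}

/-- The set `G*`. -/
def starGuards {n : ℕ} (P : Polygon Plane n) (G : Finset Plane) : Set Plane :=
  boundaryGuards P G ∪ interiorCorners P G

/-- The vertices of `P` that are darkened: two guards on `∂P` generate a dark ray
through the vertex. -/
def darkenedVertices {n : ℕ} (P : Polygon Plane n) (G : Finset Plane) : Set (Fin n) :=
  {i | ∃ a ∈ boundaryGuards P G, ∃ b ∈ boundaryGuards P G,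
    MutuallyVisible G a b ∧ P i ∈ rayBehind a b}

end DarkRays

/-! Both counts are local, one on edges and one at vertices. Of the darkness hypothesis only this is
used: two dark rays through a common point of $P$ have the same root (`AtMostOneDark`).

Boundary guards: three guards on a line leave no point of $P$ beyond the third. So an edge has at
most two guards in its relative interior, and two only if neither endpoint is a guard. Together with
maximal touching this gives, for each edge, (endpoints darkened from it) + 2 = 2 (inner guards) +
(endpoint guards), which is `edge_count`. No vertex is darkened from both of its edges, so summing
yields $2g^P = 2n + d$.

Interior corners: a corner $x$ of $C$ is the strict minimum over $G$ of a linear functional $f$, and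
is charged to a vertex $v$ of $P$ where $f$ is least. In coordinates $S, T$ vanishing on the two
edges at $v$, $f - f(v)$ is a nonnegative combination of $S$ and $T$. A supporting line of $G$
through $x$ and a visible guard carries a dark ray at $x$ descending towards the edge $T = 0$
(`exists_supporting`). If $v$ were darkened from that edge, the two rays would meet
(`false_of_sbtw`); two corners charged to $v$ would also have meeting rays (`false_of_lt`). So
charging is injective into the undarkened vertices, and $c \le n - d$. -/

namespace DarkRays

/-! ### Dark rays, their roots and visibility -/

/-- Any two dark rays that meet in a point of `K` have the same root. -/
def AtMostOneDark (K : Set Plane) (G : Finset Plane) : Prop :=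
  ∀ x ∈ K, ∀ a b a' b', MutuallyVisible G a b → MutuallyVisible G a' b' →
    Sbtw ℝ b a x → Sbtw ℝ b' a' x → a = a'

theorem sbtw_lineMap_of_one_lt {p x : Plane} (hpx : p ≠ x) {r : ℝ} (hr : 1 < r) :
    Sbtw ℝ p x (AffineMap.lineMap p x r) :=
  sbtw_iff_left_ne_and_right_mem_image_Ioi.2 ⟨hpx, r, hr, rfl⟩

theorem mem_rayBehind_iff {a b x : Plane} (hab : a ≠ b) :
    x ∈ rayBehind a b ↔ ∃ t : ℝ, 0 < t ∧ x = a + t • (a - b) := by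
  unfold rayBehind
  rw [Set.mem_ofPred_eq, sbtw_iff_left_ne_and_right_mem_image_Ioi]
  constructor
  · rintro ⟨-, r, hr, rfl⟩
    refine ⟨r - 1, sub_pos.2 hr, ?_⟩
    rw [AffineMap.lineMap_apply_module]
    module
  · rintro ⟨t, ht, rfl⟩
    refine ⟨hab.symm, t + 1, by simpa using ht, ?_⟩
    rw [AffineMap.lineMap_apply_module]
    module

/-- Equal rays are collinear, so if the roots differed, one root would lie inside the other ray and
hence inside its own, which is open there. The parameters 1 and 2 suffice to recover direction and
root. -/
theorem root_eq_of_rayBehind_eq {a b a' b' : Plane} (hab : a ≠ b) (hab' : a' ≠ b')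
    (h : rayBehind a b = rayBehind a' b') : a = a' := by
  have key : ∀ t : ℝ, 0 < t → ∃ s : ℝ, 0 < s ∧ a + t • (a - b) = a' + s • (a' - b') := by
    intro t ht
    exact (mem_rayBehind_iff hab').1 (h ▸ (mem_rayBehind_iff hab).2 ⟨t, ht, rfl⟩)
  obtain ⟨s₁, hs₁, h₁⟩ := key 1 one_pos
  obtain ⟨s₂, hs₂, h₂⟩ := key 2 two_pos
  have hk : a - b = (s₂ - s₁) • (a' - b') := by
    linear_combination (norm := module) h₂ - h₁
  have ha : a = a' + (2 * s₁ - s₂) • (a' - b') := by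
    linear_combination (norm := module) (2 : ℝ) • h₁ - h₂
  rcases lt_trichotomy (2 * s₁ - s₂) 0 with hc | hc | hc
  · have hk0 : 0 < s₂ - s₁ := by linarith
    have : a' ∈ rayBehind a b := by
      refine (mem_rayBehind_iff hab).2 ⟨(s₂ - 2 * s₁) / (s₂ - s₁), div_pos (by linarith) hk0, ?_⟩
      rw [hk, smul_smul, div_mul_cancel₀ _ hk0.ne', ha]
      module
    rw [h] at this
    exact absurd this (not_sbtw_self_right ℝ _ _)
  · rw [ha, hc]; simp
  · have : a ∈ rayBehind a' b' := (mem_rayBehind_iff hab').2 ⟨_, hc, ha⟩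
    rw [← h] at this
    exact absurd this (not_sbtw_self_right ℝ _ _)

theorem atMostOneDark_of_not_isDark {K : Set Plane} {G : Finset Plane}
    (h : ∀ x ∈ K, ¬ IsDark 2 G x) : AtMostOneDark K G := by
  intro x hx a b a' b' hab hab' hax hax'
  by_contra hne
  refine h x hx ?_
  have h1 : 1 < {R | R ∈ darkRays G ∧ x ∈ R}.encard := by
    rw [Set.one_lt_encard_iff]
    exact ⟨rayBehind a b, rayBehind a' b', ⟨⟨a, b, hab, rfl⟩, hax⟩, ⟨⟨a', b', hab', rfl⟩, hax'⟩,
      fun e => hne (root_eq_of_rayBehind_eq hab.2.2.1 hab'.2.2.1 e)⟩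
  have h2 := Order.add_one_le_of_lt h1
  rw [one_add_one_eq_two] at h2
  exact h2

/-- Looking from the guard `x` towards the guard `p`, one sees a guard on the segment. -/
theorem exists_mutuallyVisible_wbtw {G : Finset Plane} {x p : Plane} (hx : x ∈ G) (hp : p ∈ G)
    (hxp : x ≠ p) : ∃ q, MutuallyVisible G x q ∧ Wbtw ℝ p q x := by
  classical
  obtain ⟨q, hq, hmin⟩ := (G.filter fun q => q ≠ x ∧ Wbtw ℝ p q x).exists_min_image
    (fun q => dist q x) ⟨p, by simp [hp, hxp.symm]⟩
  simp only [Finset.mem_filter] at hq hmin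
  refine ⟨q, ⟨hx, hq.1, hq.2.1.symm, fun g hg hs => ?_⟩, hq.2.2⟩
  have h1 : Wbtw ℝ p g x := hq.2.2.trans_right hs.symm.wbtw
  have h2 := hmin g ⟨hg, hs.ne_left, h1⟩
  have h3 := hs.wbtw.dist_add_dist
  have h4 : 0 < dist g q := dist_pos.2 hs.ne_right
  rw [dist_comm x g, dist_comm x q] at h3
  linarith

/-- If `p`, `x`, `y` lie on a line in this order, some guard on the segment `p x` generates at `x`
a dark ray that contains `y`. -/
theorem exists_mutuallyVisible_sbtw {G : Finset Plane} {x p y : Plane} (hx : x ∈ G) (hp : p ∈ G)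
    (h : Sbtw ℝ p x y) : ∃ q, MutuallyVisible G x q ∧ Wbtw ℝ p q x ∧ Sbtw ℝ q x y := by
  obtain ⟨q, hq, hw⟩ := exists_mutuallyVisible_wbtw hx hp h.ne_left
  exact ⟨q, hq, hw, ⟨h.wbtw.trans_left_right hw, hq.2.2.1, h.ne_right⟩⟩

/-- Three guards on a line leave no further point of `K` on the line beyond the third. -/
theorem AtMostOneDark.false_of_sbtw {K : Set Plane} {G : Finset Plane} (hK : AtMostOneDark K G)
    {p q r x : Plane} (hp : p ∈ G) (hq : q ∈ G) (hr : r ∈ G) (hx : x ∈ K)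
    (h : Sbtw ℝ p q r) (h' : Sbtw ℝ q r x) : False := by
  obtain ⟨b, hb, -, hbx⟩ := exists_mutuallyVisible_sbtw hr hq h'
  obtain ⟨c, hc, -, hcx⟩ := exists_mutuallyVisible_sbtw hq hp (h.trans_expand_left h')
  exact h.ne_right (hK x hx _ _ _ _ hc hb hcx hbx)

/-! ### Interior corners near one vertex, in edge coordinates -/

/-- `x` is the only minimiser over `G` of a nonnegative combination of `S` and `T`. -/
def IsStrictMin (S T : Plane →ᵃ[ℝ] ℝ) (G : Finset Plane) (x : Plane) : Prop :=
  ∃ α β : ℝ, 0 ≤ α ∧ 0 ≤ β ∧ ∀ g ∈ G, g ≠ x → α * S x + β * T x < α * S g + β * T g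

theorem IsStrictMin.swap {S T : Plane →ᵃ[ℝ] ℝ} {G : Finset Plane} {x : Plane}
    (h : IsStrictMin S T G x) : IsStrictMin T S G x := by
  obtain ⟨α, β, hα, hβ, h⟩ := h
  exact ⟨β, α, hβ, hα, fun g hg hgx => by linarith [h g hg hgx]⟩

/-- The data at a vertex `v` of a convex region `K` in coordinates `S`, `T` that vanish on the two
edges at `v`; the guards `a` and `b` lie on the two edges. -/
structure IsWedge (K : Set Plane) (G : Finset Plane) (S T : Plane →ᵃ[ℝ] ℝ) (v a b : Plane) :
    Prop where
  convex : Convex ℝ K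
  inj : ∀ x y, S x = S y → T x = T y → x = y
  v_mem : v ∈ K
  a_mem : a ∈ K
  b_mem : b ∈ K
  a_guard : a ∈ G
  b_guard : b ∈ G
  S_v : S v = 0
  T_v : T v = 0
  S_a : 0 < S a
  T_a : T a = 0
  S_b : S b = 0
  T_b : 0 < T b
  S_nonneg : ∀ g ∈ G, 0 ≤ S g
  T_nonneg : ∀ g ∈ G, 0 ≤ T g
  dark : AtMostOneDark K G

namespace IsWedge

variable {K : Set Plane} {G : Finset Plane} {S T : Plane →ᵃ[ℝ] ℝ} {v a b x y : Plane}

theorem swap (h : IsWedge K G S T v a b) : IsWedge K G T S v b a :=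
  ⟨h.convex, fun x y h1 h2 => h.inj x y h2 h1, h.v_mem, h.b_mem, h.a_mem, h.b_guard, h.a_guard,
    h.T_v, h.S_v, h.T_b, h.S_b, h.T_a, h.S_a, h.T_nonneg, h.S_nonneg, h.dark⟩

/-- The line $T + mS = c$ meets the coordinate axes no farther from $v$ than $a$ and $b$, so its
part in the quadrant lies in the triangle $v, a, b$. The barycentric weights of $q$ are $S q / S a$
and $T q / T b$. -/
theorem mem_of_le (h : IsWedge K G S T v a b) {q : Plane} {m c : ℝ} (hm : 0 < m)
    (hS : 0 ≤ S q) (hT : 0 ≤ T q) (hq : T q + m * S q = c) (ha : c ≤ m * S a) (hb : c ≤ T b) :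
    q ∈ K := by
  have hSa := h.S_a
  have hTb := h.T_b
  have h1 : S q / S a + T q / T b ≤ 1 := by
    rcases eq_or_lt_of_le (show 0 ≤ c by rw [← hq]; positivity) with hc | hc
    · have e1 : S q = 0 := by nlinarith
      have e2 : T q = 0 := by nlinarith
      simp [e1, e2]
    · have e1 : S q / S a ≤ m * S q / c := by
        rw [div_le_div_iff₀ hSa hc]; nlinarith
      have e2 : T q / T b ≤ T q / c := by gcongr
      have e3 : m * S q / c + T q / c = 1 := by
        rw [← add_div, add_comm, hq, div_self hc.ne']
      linarith
  set w₁ := S q / S a with hw₁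
  set w₂ := T q / T b with hw₂
  have hw₁0 : 0 ≤ w₁ := by positivity
  have hw₂0 : 0 ≤ w₂ := by positivity
  have e : q = v + w₁ • (a - v) + w₂ • (b - v) := by
    have key : ∀ F : Plane →ᵃ[ℝ] ℝ, F (v + w₁ • (a - v) + w₂ • (b - v)) =
        F v + w₁ * (F a - F v) + w₂ * (F b - F v) := by
      intro F
      have e : v + w₁ • (a - v) + w₂ • (b - v) =
          (w₁ • (a - v) + w₂ • (b - v)) +ᵥ v := by
        rw [vadd_eq_add]; abel
      have ea := F.linearMap_vsub a v
      have eb := F.linearMap_vsub b v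
      simp only [vsub_eq_sub] at ea eb
      rw [e, F.map_vadd, map_add, map_smul, map_smul, ea, eb, vadd_eq_add, smul_eq_mul,
        smul_eq_mul]
      ring
    apply h.inj
    · rw [key, h.S_v, h.S_b, hw₁]
      field_simp
      ring
    · rw [key, h.T_v, h.T_a, hw₂]
      field_simp
      ring
  have e' : q = (1 - w₁ - w₂) • v + w₁ • a + w₂ • b := by rw [e]; module
  rw [e']
  have := h.convex.sum_mem (t := Finset.univ) (w := ![1 - w₁ - w₂, w₁, w₂]) (z := ![v, a, b])
    (by
      intro i _
      fin_cases i
      · show 0 ≤ 1 - w₁ - w₂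
        linarith
      · exact hw₁0
      · exact hw₂0)
    (by simp [Fin.sum_univ_three]; ring)
    (by
      intro i _
      fin_cases i
      exacts [h.v_mem, h.a_mem, h.b_mem])
  simpa [Fin.sum_univ_three] using this

theorem pos_right (h : IsWedge K G S T v a b) (hx : x ∈ G) (hS : 0 < S x) {α β : ℝ} (hα : 0 ≤ α)
    (hβ : 0 ≤ β) (hmin : ∀ g ∈ G, g ≠ x → α * S x + β * T x < α * S g + β * T g) : 0 < β := by
  have := hmin b h.b_guard (by rintro rfl; exact hS.ne' h.S_b)
  rcases hβ.eq_or_lt with rfl | h0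
  · rw [h.S_b] at this; nlinarith
  · exact h0

/-- The guard that precedes a corner `x` on the hull, with the supporting line through both. -/
theorem exists_supporting (h : IsWedge K G S T v a b) (hx : x ∈ G) (hS : 0 < S x)
    (hmin : IsStrictMin S T G x) :
    ∃ p m, MutuallyVisible G x p ∧ 0 < m ∧ S p < S x ∧ T p - T x = m * (S x - S p) ∧
      (∀ g ∈ G, 0 ≤ T g - T x + m * (S g - S x)) ∧
      ∀ g ∈ G, g ≠ x → S x ≤ S g → 0 < T g - T x + m * (S g - S x) := by
  classical
  obtain ⟨α, β, hα, hβ, hmin⟩ := hmin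
  have hβ0 := h.pos_right hx hS hα hβ hmin
  -- Among guards with smaller $S$, take one of least slope as seen from $x$; the others then lie on
  -- or above the line through it. The guard $b$ makes the choice nonempty.
  obtain ⟨p₀, hp₀, hp₀min⟩ := (G.filter fun g => S g < S x).exists_min_image
    (fun g => (T g - T x) / (S x - S g)) ⟨b, by simp [h.b_guard, h.S_b, hS]⟩
  simp only [Finset.mem_filter] at hp₀ hp₀min
  obtain ⟨hp₀G, hp₀S⟩ := hp₀
  have hne : p₀ ≠ x := by rintro rfl; exact lt_irrefl _ hp₀S
  set m := (T p₀ - T x) / (S x - S p₀) with hm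
  have hd : 0 < S x - S p₀ := sub_pos.2 hp₀S
  have hmeq : T p₀ - T x = m * (S x - S p₀) := by rw [hm, div_mul_cancel₀ _ hd.ne']
  -- This line is steeper than the level lines of the functional minimised at $x$, so guards with
  -- $S$ at least $S x$ stay strictly above it.
  have hmα : α < β * m := by
    have := hmin p₀ hp₀G hne
    have : α * (S x - S p₀) < (β * m) * (S x - S p₀) := by
      rw [mul_assoc, ← hmeq]; linarith
    exact lt_of_mul_lt_mul_right this hd.le
  have hm0 : 0 < m := pos_of_mul_pos_right (hα.trans_lt hmα) hβ
  have hstrict : ∀ g ∈ G, g ≠ x → S x ≤ S g → 0 < T g - T x + m * (S g - S x) := by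
    intro g hg hgx hSg
    have h1 := hmin g hg hgx
    have h2 : α * (S g - S x) ≤ (β * m) * (S g - S x) :=
      mul_le_mul_of_nonneg_right hmα.le (sub_nonneg.2 hSg)
    have h3 : 0 < β * (T g - T x + m * (S g - S x)) := by linarith
    exact pos_of_mul_pos_right h3 hβ
  obtain ⟨p, hp, hw⟩ := exists_mutuallyVisible_wbtw hx hp₀G hne.symm
  obtain ⟨r, ⟨hr0, hr1⟩, rfl⟩ := hw
  have hr : r ≠ 1 := by
    rintro rfl
    exact hp.2.2.1 (by simp)
  have hr1 : r < 1 := lt_of_le_of_ne hr1 hr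
  have eS : S (AffineMap.lineMap p₀ x r) = S p₀ + r * (S x - S p₀) := by
    rw [AffineMap.apply_lineMap, AffineMap.lineMap_apply_ring']; ring
  have eT : T (AffineMap.lineMap p₀ x r) = T p₀ + r * (T x - T p₀) := by
    rw [AffineMap.apply_lineMap, AffineMap.lineMap_apply_ring']; ring
  refine ⟨_, m, hp, hm0, ?_, ?_, ?_, hstrict⟩
  · rw [eS]; nlinarith
  · rw [eS, eT]; linear_combination (1 - r) * hmeq
  · intro g hg
    rcases lt_or_ge (S g) (S x) with hlt | hge
    · have h1 := hp₀min g ⟨hg, hlt⟩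
      rw [le_div_iff₀ (sub_pos.2 hlt)] at h1
      linarith
    · rcases eq_or_ne g x with rfl | hgx
      · simp
      · exact (hstrict g hg hgx hge).le

/-- If the dark ray of a guard on the edge at `a` covers `v`, there is no inner corner at `v`. -/
theorem false_of_sbtw (h : IsWedge K G S T v a b) (hx : x ∈ G) (hS : 0 < S x) (hT : 0 < T x)
    (hmin : IsStrictMin S T G x) {a' : Plane} (ha' : MutuallyVisible G a a')
    (hv : Sbtw ℝ a' a v) : False := by
  obtain ⟨p, m, hp, hm, hSp, hTp, hle, hlt⟩ := h.exists_supporting hx hS hmin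
  have hd : 0 < S x - S p := sub_pos.2 hSp
  -- Chosen so that the extension beyond $x$ reaches the edge $T = 0$ at $q$. As $a$ lies strictly
  -- above the supporting line, $q$ falls strictly between $a$ and $v$, on the ray that covers $v$.
  set r : ℝ := 1 + T x / (m * (S x - S p)) with hr
  have hr1 : 1 < r := by
    have : 0 < T x / (m * (S x - S p)) := by positivity
    linarith
  set q : Plane := AffineMap.lineMap p x r with hq
  have eS : S q = S x + T x / m := by
    rw [hq, AffineMap.apply_lineMap, AffineMap.lineMap_apply_ring', hr]
    field_simp
    ring
  have eT : T q = 0 := by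
    rw [hq, AffineMap.apply_lineMap, AffineMap.lineMap_apply_ring', hr,
      show T p = T x + m * (S x - S p) by linarith]
    field_simp
    ring
  have hax : a ≠ x := by rintro rfl; exact hT.ne' h.T_a
  have hSax : S x < S a := by
    by_contra hcon
    have := hle a h.a_guard
    rw [h.T_a] at this
    nlinarith
  have hqa : S q < S a := by
    have := hlt a h.a_guard hax hSax.le
    rw [h.T_a] at this
    rw [eS, ← lt_sub_iff_add_lt', div_lt_iff₀ hm]
    linarith
  have hSq : 0 < S q := by rw [eS]; positivity
  have hqv : q = AffineMap.lineMap a v (1 - S q / S a) := by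
    clear_value q
    apply h.inj
    · rw [AffineMap.apply_lineMap, AffineMap.lineMap_apply_ring', h.S_v]
      have := h.S_a
      field_simp
      ring
    · rw [AffineMap.apply_lineMap, AffineMap.lineMap_apply_ring', h.T_v, h.T_a, eT]
      ring
  have hwq : Wbtw ℝ a q v := by
    refine ⟨1 - S q / S a, ⟨?_, ?_⟩, hqv.symm⟩
    · rw [sub_nonneg, div_le_one h.S_a]; exact hqa.le
    · have : 0 < S q / S a := div_pos hSq h.S_a
      linarith
  have hqK : q ∈ K := h.convex.segment_subset h.a_mem h.v_mem (mem_segment_iff_wbtw.2 hwq)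
  have hne : a ≠ q := fun e => hqa.ne (by rw [← e])
  have hray : Sbtw ℝ a' a q := ⟨hv.wbtw.trans_right_left hwq, hv.ne_left, hne⟩
  exact hax (h.dark q hqK a a' x p ha' hp hray (sbtw_lineMap_of_one_lt hp.2.2.1.symm hr1))

/-- From $x$ a dark ray descends with $S$ increasing, from $y$ another with $T$ increasing. Each
corner lies strictly above the other's supporting line, so the rays cross, and they do so in the
triangle $v, a, b$. -/
theorem false_of_lt (h : IsWedge K G S T v a b) (hx : x ∈ G) (hSx : 0 < S x)
    (hxmin : IsStrictMin S T G x) (hy : y ∈ G) (hTy : 0 < T y) (hymin : IsStrictMin S T G y)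
    (hS : S x < S y) (hT : T y < T x) : False := by
  obtain ⟨p, m, hp, hm, hSp, hTp, hle, hlt⟩ := h.exists_supporting hx hSx hxmin
  obtain ⟨p', m', hp', hm', hTp', hSp', -, hlt'⟩ := h.swap.exists_supporting hy hTy hymin.swap
  have hxy : x ≠ y := by rintro rfl; exact lt_irrefl _ hS
  have h1 := hlt y hy hxy.symm hS.le
  have h2 := hlt' x hx hxy hT.le
  -- The two strict inequalities say that the chord $xy$ is less steep than the line at $x$ and
  -- steeper than the line at $y$; multiplying them gives $mm' > 1$.
  have hmm : 0 < m * m' - 1 := by nlinarith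
  have hd : 0 < S x - S p := sub_pos.2 hSp
  have hd' : 0 < T y - T p' := sub_pos.2 hTp'
  -- `σ` and `σ'` solve the linear system for the crossing point: the advance in $S$ from $x$ and in
  -- $T$ from $y$.
  set σ := (S x - S y + m' * (T x - T y)) / (m * m' - 1) with hσ
  set σ' := (T y - T x + m * (S y - S x)) / (m * m' - 1) with hσ'
  have hσ0 : 0 < σ := div_pos h2 hmm
  have hσ0' : 0 < σ' := div_pos h1 hmm
  have eσ : σ * (m * m' - 1) = S x - S y + m' * (T x - T y) := div_mul_cancel₀ _ hmm.ne'
  have eσ' : σ' * (m * m' - 1) = T y - T x + m * (S y - S x) := div_mul_cancel₀ _ hmm.ne'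
  set r := 1 + σ / (S x - S p) with hr
  set r' := 1 + σ' / (T y - T p') with hr'
  have hr1 : 1 < r := by have : 0 < σ / (S x - S p) := by positivity
                         linarith
  have hr1' : 1 < r' := by have : 0 < σ' / (T y - T p') := by positivity
                           linarith
  set q : Plane := AffineMap.lineMap p x r with hq
  set q' : Plane := AffineMap.lineMap p' y r' with hq'
  have eS : S q = S x + σ := by
    rw [hq, AffineMap.apply_lineMap, AffineMap.lineMap_apply_ring', hr]
    field_simp
    ring
  have eT : T q = T x - m * σ := by
    rw [hq, AffineMap.apply_lineMap, AffineMap.lineMap_apply_ring', hr,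
      show T p = T x + m * (S x - S p) by linarith]
    field_simp
    ring
  have eT' : T q' = T y + σ' := by
    rw [hq', AffineMap.apply_lineMap, AffineMap.lineMap_apply_ring', hr']
    field_simp
    ring
  have eS' : S q' = S y - m' * σ' := by
    rw [hq', AffineMap.apply_lineMap, AffineMap.lineMap_apply_ring', hr',
      show S p' = S y + m' * (T y - T p') by linarith]
    field_simp
    ring
  have hqq : q = q' := by
    apply h.inj
    · rw [eS, eS']
      apply mul_right_cancel₀ hmm.ne'
      linear_combination eσ + m' * eσ'
    · rw [eT, eT']
      apply mul_right_cancel₀ hmm.ne'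
      linear_combination -m * eσ - eσ'
  have hqK : q ∈ K := by
    refine h.mem_of_le hm (c := T x + m * S x) ?_ ?_ ?_ ?_ ?_
    · rw [eS]; positivity
    · rw [hqq, eT']; positivity
    · rw [eS, eT]; ring
    · have := hle a h.a_guard
      rw [h.T_a] at this; linarith
    · have := hle b h.b_guard
      rw [h.S_b] at this; linarith
  refine hxy (h.dark q hqK x p y p' hp hp' (sbtw_lineMap_of_one_lt hp.2.2.1.symm hr1) ?_)
  rw [hqq]
  exact sbtw_lineMap_of_one_lt hp'.2.2.1.symm hr1'

/-- There is at most one inner corner at each vertex. -/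
theorem eq_of_isStrictMin (h : IsWedge K G S T v a b) (hx : x ∈ G) (hSx : 0 < S x) (hTx : 0 < T x)
    (hxmin : IsStrictMin S T G x) (hy : y ∈ G) (hSy : 0 < S y) (hTy : 0 < T y)
    (hymin : IsStrictMin S T G y) : x = y := by
  by_contra hne
  obtain ⟨α, β, hα, hβ, h1⟩ := hxmin
  obtain ⟨α', β', hα', hβ', h2⟩ := hymin
  have e1 := h1 y hy (Ne.symm hne)
  have e2 := h2 x hx hne
  -- If both coordinates of one point are at most those of the other, the larger one cannot be a
  -- strict minimum of a nonnegative combination; the remaining cases are `false_of_lt`.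
  rcases lt_or_ge (S x) (S y) with hS | hS <;> rcases lt_or_ge (T x) (T y) with hT | hT
  · nlinarith
  · rcases hT.eq_or_lt with hT | hT
    · rw [hT] at e2; nlinarith
    · exact h.false_of_lt hx hSx ⟨α, β, hα, hβ, h1⟩ hy hTy ⟨α', β', hα', hβ', h2⟩ hS hT
  · rcases hS.eq_or_lt with hS | hS
    · rw [hS] at e2; nlinarith
    · exact h.false_of_lt hy hSy ⟨α', β', hα', hβ', h2⟩ hx hTx ⟨α, β, hα, hβ, h1⟩ hS hT
  · nlinarith

end IsWedge
-- Cyclic indices and signed area as an affine form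
theorem finRotate_ne_self {n : ℕ} (hn : 3 ≤ n) (i : Fin n) : finRotate n i ≠ i := by
  obtain ⟨m, rfl⟩ : ∃ m, n = m + 1 := ⟨n - 1, by omega⟩
  obtain ⟨i, hi⟩ := i
  rw [finRotate_apply, Ne, Fin.ext_iff, Fin.val_add_one]
  split_ifs with h
  · rw [Fin.ext_iff] at h; simp at h ⊢; omega
  · simp

theorem finRotate_finRotate_ne_self {n : ℕ} (hn : 3 ≤ n) (i : Fin n) :
    finRotate n (finRotate n i) ≠ i := by
  obtain ⟨m, rfl⟩ : ∃ m, n = m + 1 := ⟨n - 1, by omega⟩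
  obtain ⟨i, hi⟩ := i
  rw [finRotate_apply, finRotate_apply, Ne, Fin.ext_iff, Fin.val_add_one,
    Fin.val_add_one]
  simp only [Fin.ext_iff, Fin.val_add_one, Fin.val_last]
  split_ifs <;> omega

/-- `cross` as an affine function of its last argument. -/
def crossForm (a b : Plane) : Plane →ᵃ[ℝ] ℝ where
  toFun := cross a b
  linear :=
    { toFun := fun x => (b 0 - a 0) * x 1 - (b 1 - a 1) * x 0
      map_add' := fun x y => by simp only [PiLp.add_apply]; ring
      map_smul' := fun c x => by
        simp only [PiLp.smul_apply, smul_eq_mul, RingHom.id_apply]; ring }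
  map_vadd' := fun p v => by
    simp only [vadd_eq_add, LinearMap.coe_mk, AddHom.coe_mk, cross, PiLp.add_apply]; ring

theorem crossForm_apply (a b x : Plane) : crossForm a b x = cross a b x := rfl

theorem cross_lineMap (a b x y : Plane) (r : ℝ) :
    cross a b (AffineMap.lineMap x y r) = (1 - r) * cross a b x + r * cross a b y := by
  rw [← crossForm_apply, AffineMap.apply_lineMap, AffineMap.lineMap_apply_ring]; rfl

theorem cross_self_left (a b : Plane) : cross a b a = 0 := by simp [cross]

theorem cross_self_right (a b : Plane) : cross a b b = 0 := by simp [cross]; ring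

theorem cross_eq_zero_of_wbtw {a b x : Plane} (h : Wbtw ℝ a x b) : cross a b x = 0 := by
  obtain ⟨r, -, rfl⟩ := h
  rw [cross_lineMap, cross_self_left, cross_self_right]; ring

/-- Cramer's rule: the forms of two nonparallel lines through $v$ are affine coordinates of the
plane. -/
theorem eq_of_cross_eq {a v d x y : Plane} (h : cross a v d ≠ 0)
    (h₁ : cross v d x = cross v d y) (h₂ : cross a v x = cross a v y) : x = y := by
  have key : ∀ k, k = 0 ∨ k = 1 → cross a v d * x k = cross a v d * y k := by
    unfold cross at *
    rintro k (rfl | rfl)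
    · linear_combination -(v 0 - a 0) * h₁ + (d 0 - v 0) * h₂
    · linear_combination -(v 1 - a 1) * h₁ + (d 1 - v 1) * h₂
  ext k
  refine mul_left_cancel₀ h (key k ?_)
  fin_cases k <;> simp

/-! ### Convex polygons: edges, interior, coordinates at a vertex -/

section Polygon

variable {n : ℕ} {P : Polygon Plane n}

theorem vertex_mem_region (P : Polygon Plane n) (i : Fin n) : P i ∈ region P :=
  subset_convexHull ℝ _ ⟨i, rfl⟩

theorem convex_region (P : Polygon Plane n) : Convex ℝ (region P) := convex_convexHull ℝ _

theorem mem_boundary_iff {x : Plane} :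
    x ∈ P.boundary ℝ ↔ ∃ i, Wbtw ℝ (P i) x (P (finRotate n i)) := by
  simp [Polygon.boundary, Polygon.edgeSet, Wbtw]

theorem IsConvexPolygon.cross_vertex_nonneg (hP : IsConvexPolygon P) (i j : Fin n) :
    0 ≤ cross (P i) (P (finRotate n i)) (P j) := by
  rcases eq_or_ne j i with rfl | h1
  · rw [cross_self_left]
  rcases eq_or_ne j (finRotate n i) with rfl | h2
  · rw [cross_self_right]
  · exact (hP.2 i j h1 h2).le

theorem IsConvexPolygon.eq_or_eq_of_cross (hP : IsConvexPolygon P) {i j : Fin n}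
    (h : cross (P i) (P (finRotate n i)) (P j) = 0) : j = i ∨ j = finRotate n i := by
  by_contra! hc
  exact (hP.2 i j hc.1 hc.2).ne' h

theorem IsConvexPolygon.cross_nonneg (hP : IsConvexPolygon P) (i : Fin n) {x : Plane}
    (hx : x ∈ region P) : 0 ≤ cross (P i) (P (finRotate n i)) x := by
  have hc : Convex ℝ (crossForm (P i) (P (finRotate n i)) ⁻¹' Set.Ici 0) :=
    (convex_Ici 0).affine_preimage _
  refine convexHull_min ?_ hc hx
  rintro _ ⟨j, rfl⟩
  exact hP.cross_vertex_nonneg i j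

/-- The open half-plane of an edge together with the edge itself is convex and contains every
vertex, hence the whole region. -/
theorem IsConvexPolygon.wbtw_of_cross_eq_zero (hP : IsConvexPolygon P) {i : Fin n} {x : Plane}
    (hx : x ∈ region P) (h : cross (P i) (P (finRotate n i)) x = 0) :
    Wbtw ℝ (P i) x (P (finRotate n i)) := by
  have hc : Convex ℝ {y | 0 < cross (P i) (P (finRotate n i)) y ∨
      y ∈ segment ℝ (P i) (P (finRotate n i))} := by
    rw [convex_iff_segment_subset]
    intro y hy z hz w hw
    have hy0 : 0 ≤ cross (P i) (P (finRotate n i)) y := by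
      rcases hy with hy | hy
      · exact hy.le
      · exact (cross_eq_zero_of_wbtw (mem_segment_iff_wbtw.1 hy)).ge
    have hz0 : 0 ≤ cross (P i) (P (finRotate n i)) z := by
      rcases hz with hz | hz
      · exact hz.le
      · exact (cross_eq_zero_of_wbtw (mem_segment_iff_wbtw.1 hz)).ge
    rcases hy with hy | hy <;> rcases hz with hz | hz
    rotate_right
    · exact Or.inr ((convex_segment _ _).segment_subset hy hz hw)
    all_goals
      obtain ⟨r, ⟨hr0, hr1⟩, rfl⟩ := mem_segment_iff_wbtw.1 hw
      rcases hr0.eq_or_lt with rfl | hr0'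
      · first | exact Or.inl (by simpa using hy) | exact Or.inr (by simpa using hy)
      rcases hr1.eq_or_lt with rfl | hr1'
      · first | exact Or.inl (by simpa using hz) | exact Or.inr (by simpa using hz)
      refine Or.inl ?_
      rw [cross_lineMap]
      have := sub_pos.2 hr1'
      positivity
  have hx' := convexHull_min (s := Set.range P.vertices) ?_ hc hx
  · rcases hx' with hx' | hx'
    · exact absurd h hx'.ne'
    · exact mem_segment_iff_wbtw.1 hx'
  · rintro _ ⟨j, rfl⟩
    rcases eq_or_ne j i with rfl | h1
    · exact Or.inr (left_mem_segment _ _ _)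
    rcases eq_or_ne j (finRotate n i) with rfl | h2
    · exact Or.inr (right_mem_segment _ _ _)
    · exact Or.inl (hP.2 i j h1 h2)

theorem IsConvexPolygon.vertices_injective (hP : IsConvexPolygon P) :
    Function.Injective P.vertices := by
  intro i j hij
  have h1 := hP.eq_or_eq_of_cross (i := i) (j := j) (by rw [← hij, cross_self_left])
  have h2 := hP.eq_or_eq_of_cross (i := j) (j := i) (by rw [hij, cross_self_left])
  rcases h1 with h1 | h1
  · exact h1.symm
  rcases h2 with h2 | h2
  · exact h2
  · exact absurd (h1 ▸ h2.symm : finRotate n (finRotate n i) = i)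
      (finRotate_finRotate_ne_self hP.1 i)

theorem IsConvexPolygon.edge_ne (hP : IsConvexPolygon P) (i : Fin n) :
    P i ≠ P (finRotate n i) :=
  fun h => finRotate_ne_self hP.1 i (hP.vertices_injective h).symm

/-- An interior point can be pushed slightly away from a vertex `z` off the edge without leaving the
region; from a point on the edge line this push would make the form negative. -/
theorem IsConvexPolygon.cross_pos_of_mem_interior (hP : IsConvexPolygon P) (i : Fin n) {x : Plane}
    (hx : x ∈ interior (region P)) : 0 < cross (P i) (P (finRotate n i)) x := by
  set z := P (finRotate n (finRotate n i)) with hz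
  have hz0 : 0 < cross (P i) (P (finRotate n i)) z :=
    hP.2 i _ (finRotate_finRotate_ne_self hP.1 i) (finRotate_ne_self hP.1 _)
  have hcont : Filter.Tendsto (fun r : ℝ => AffineMap.lineMap z x r) (nhds 1) (nhds x) := by
    have : Continuous fun r : ℝ => AffineMap.lineMap z x r := AffineMap.lineMap_continuous
    simpa using this.tendsto 1
  have hev := hcont.eventually (mem_interior_iff_mem_nhds.1 hx)
  obtain ⟨r, hr, hr1⟩ := ((hev.filter_mono nhdsWithin_le_nhds).and
    (self_mem_nhdsWithin : Set.Ioi (1 : ℝ) ∈ nhdsWithin 1 (Set.Ioi 1))).exists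
  have h1 := hP.cross_nonneg i hr
  rw [cross_lineMap] at h1
  have hr1' : (1 : ℝ) < r := hr1
  by_contra hcon
  nlinarith

/-- A line segment in the polygon whose relative interior meets an edge lies in the edge. -/
theorem IsConvexPolygon.wbtw_of_sbtw (hP : IsConvexPolygon P) {i : Fin n} {x y z : Plane}
    (hx : x ∈ region P) (hz : z ∈ region P) (h : Sbtw ℝ x y z)
    (hy : Wbtw ℝ (P i) y (P (finRotate n i))) :
    Wbtw ℝ (P i) x (P (finRotate n i)) ∧ Wbtw ℝ (P i) z (P (finRotate n i)) := by
  have hy0 := cross_eq_zero_of_wbtw hy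
  have hx0 := hP.cross_nonneg i hx
  have hz0 := hP.cross_nonneg i hz
  obtain ⟨r, ⟨hr0, hr1⟩, rfl⟩ := h.mem_image_Ioo
  rw [cross_lineMap] at hy0
  exact ⟨hP.wbtw_of_cross_eq_zero hx (by nlinarith), hP.wbtw_of_cross_eq_zero hz (by nlinarith)⟩

theorem IsConvexPolygon.eq_or_eq_of_wbtw (hP : IsConvexPolygon P) {i j : Fin n}
    (h : Wbtw ℝ (P i) (P j) (P (finRotate n i))) : j = i ∨ j = finRotate n i :=
  hP.eq_or_eq_of_cross (cross_eq_zero_of_wbtw h)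

theorem IsConvexPolygon.isWedge (hP : IsConvexPolygon P) {G : Finset Plane}
    (hG : ∀ g ∈ G, g ∈ region P) (hdark : AtMostOneDark (region P) G) (i : Fin n) {a b : Plane}
    (ha : a ∈ G) (hb : b ∈ G) (hai : Wbtw ℝ (P i) a (P (finRotate n i)))
    (hbi : Wbtw ℝ (P (finRotate n i)) b (P (finRotate n (finRotate n i))))
    (hav : a ≠ P (finRotate n i)) (hbv : b ≠ P (finRotate n i)) :
    IsWedge (region P) G (crossForm (P (finRotate n i)) (P (finRotate n (finRotate n i))))
      (crossForm (P i) (P (finRotate n i))) (P (finRotate n i)) a b where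
  convex := convex_region P
  inj x y h1 h2 := eq_of_cross_eq
    (hP.2 i _ (finRotate_finRotate_ne_self hP.1 i) (finRotate_ne_self hP.1 _)).ne' h1 h2
  v_mem := vertex_mem_region P _
  a_mem := hG a ha
  b_mem := hG b hb
  a_guard := ha
  b_guard := hb
  S_v := cross_self_left _ _
  T_v := cross_self_right _ _
  S_a := by
    refine lt_of_le_of_ne (hP.cross_nonneg _ (hG a ha)) fun h0 => hav ?_
    have h1 := hP.wbtw_of_cross_eq_zero (hG a ha) h0.symm
    exact eq_of_cross_eq
      (hP.2 i _ (finRotate_finRotate_ne_self hP.1 i) (finRotate_ne_self hP.1 _)).ne'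
      (by rw [cross_self_left]; exact h0.symm)
      (by rw [cross_self_right]; exact cross_eq_zero_of_wbtw hai)
  T_a := cross_eq_zero_of_wbtw hai
  S_b := cross_eq_zero_of_wbtw hbi
  T_b := by
    refine lt_of_le_of_ne (hP.cross_nonneg _ (hG b hb)) fun h0 => hbv ?_
    exact eq_of_cross_eq
      (hP.2 i _ (finRotate_finRotate_ne_self hP.1 i) (finRotate_ne_self hP.1 _)).ne'
      (by rw [cross_self_left]; exact cross_eq_zero_of_wbtw hbi)
      (by rw [cross_self_right]; exact h0.symm)
  S_nonneg g hg := hP.cross_nonneg _ (hG g hg)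
  T_nonneg g hg := hP.cross_nonneg _ (hG g hg)
  dark := hdark

/-- A corner of the hull is the unique minimum of some linear functional. -/
theorem exists_strictMin_of_mem_extremePoints {G : Finset Plane} {x : Plane}
    (hx : x ∈ (convexHull ℝ (G : Set Plane)).extremePoints ℝ) :
    ∃ f : Plane →L[ℝ] ℝ, ∀ g ∈ G, g ≠ x → f x < f g := by
  classical
  have hx' : x ∉ convexHull ℝ ((G.erase x : Finset Plane) : Set Plane) := by
    intro hmem
    -- Removing an extreme point leaves a convex set, which contains the hull of the other guards;
    -- Hahn–Banach then separates $x$ from that hull.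
    rw [(convex_convexHull ℝ _).mem_extremePoints_iff_convex_sdiff] at hx
    have hsub : ((G.erase x : Finset Plane) : Set Plane) ⊆ convexHull ℝ (G : Set Plane) \ {x} := by
      intro g hg
      rw [Finset.mem_coe, Finset.mem_erase] at hg
      exact ⟨subset_convexHull ℝ _ hg.2, hg.1⟩
    exact (convexHull_min hsub hx.2 hmem).2 rfl
  obtain ⟨f, u, h1, h2⟩ := geometric_hahn_banach_point_closed (convex_convexHull ℝ _)
    ((G.erase x).finite_toSet.isCompact_convexHull (𝕜 := ℝ)).isClosed hx'
  exact ⟨f, fun g hg hgx => h1.trans (h2 g (subset_convexHull ℝ _ (by simp [hg, hgx])))⟩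

/-- Expands $f - f(v)$ in the two edge forms at $v$. The coefficients are the increments of $f$
along the edges, hence nonnegative when $v$ minimises $f$ on the vertices. -/
theorem cross_mul_sub (f : Plane →L[ℝ] ℝ) (a v d x : Plane) :
    (f a - f v) * cross v d x + (f d - f v) * cross a v x = cross a v d * (f x - f v) := by
  have hf : ∀ y : Plane, f y = y 0 * f (EuclideanSpace.single 0 1) +
      y 1 * f (EuclideanSpace.single 1 1) := by
    intro y
    have : y = y 0 • EuclideanSpace.single 0 1 + y 1 • EuclideanSpace.single 1 1 := by
      ext k
      fin_cases k <;> simp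
    conv_lhs => rw [this]
    simp
  rw [hf a, hf v, hf d, hf x]
  unfold cross
  ring

/-- A guard that minimises a linear functional is a strict minimum in the coordinates at a vertex
where the functional is least. -/
theorem IsConvexPolygon.exists_isStrictMin (hP : IsConvexPolygon P) {G : Finset Plane} {x : Plane}
    (hxG : x ∈ interiorCorners P G) :
    ∃ i, P (finRotate n i) ∉ G ∧
      IsStrictMin (crossForm (P (finRotate n i)) (P (finRotate n (finRotate n i))))
        (crossForm (P i) (P (finRotate n i))) G x := by
  obtain ⟨hxG, hext, hint⟩ := hxG
  obtain ⟨f, hf⟩ := exists_strictMin_of_mem_extremePoints hext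
  have : Nonempty (Fin n) := ⟨⟨0, by have := hP.1; omega⟩⟩
  obtain ⟨k, hk⟩ := Finite.exists_min fun k => f (P k)
  obtain ⟨i, rfl⟩ := (finRotate n).surjective k
  have hΔ : 0 < cross (P i) (P (finRotate n i)) (P (finRotate n (finRotate n i))) :=
    hP.2 i _ (finRotate_finRotate_ne_self hP.1 i) (finRotate_ne_self hP.1 _)
  refine ⟨i, fun hmem => ?_, f (P i) - f (P (finRotate n i)),
    f (P (finRotate n (finRotate n i))) - f (P (finRotate n i)), sub_nonneg.2 (hk _),
    sub_nonneg.2 (hk _), fun g hg hgx => ?_⟩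
  -- A guard at this vertex would have a larger value of $f$ than $x$, but $f$ is least there on the
  -- whole region.
  · have hne : P (finRotate n i) ≠ x := by
      intro e
      have := hP.cross_pos_of_mem_interior i hint
      rw [← e, cross_self_right] at this
      exact lt_irrefl _ this
    have h1 := hf _ hmem hne
    have hc : Convex ℝ (f ⁻¹' Set.Ici (f (P (finRotate n i)))) :=
      (convex_Ici _).linear_preimage f.toLinearMap
    have h2 : x ∈ f ⁻¹' Set.Ici (f (P (finRotate n i))) := by
      refine convexHull_min ?_ hc (interior_subset hint)
      rintro _ ⟨j, rfl⟩
      exact hk j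
    exact absurd h1 (not_lt.2 h2)
  · simp only [crossForm_apply]
    rw [cross_mul_sub, cross_mul_sub]
    have := hf g hg hgx
    gcongr

end Polygon

/-! ### Guards on the edges and the edge count -/

theorem sbtw_or_sbtw_of_wbtw {a b p q : Plane} (hp : Wbtw ℝ a p b) (hq : Wbtw ℝ a q b)
    (hpq : p ≠ q) (hpb : p ≠ b) (hqb : q ≠ b) : Sbtw ℝ p q b ∨ Sbtw ℝ q p b := by
  obtain ⟨r, ⟨hr0, hr1⟩, rfl⟩ := hp
  obtain ⟨s, ⟨hs0, hs1⟩, rfl⟩ := hq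
  have hab : a ≠ b := by rintro rfl; simp at hpq
  have hinj : Function.Injective (AffineMap.lineMap a b : ℝ →ᵃ[ℝ] Plane) :=
    AffineMap.lineMap_injective ℝ hab
  have hr : r < 1 := lt_of_le_of_ne hr1 (by rintro rfl; simp at hpb)
  have hs : s < 1 := lt_of_le_of_ne hs1 (by rintro rfl; simp at hqb)
  have e : b = (AffineMap.lineMap a b : ℝ →ᵃ[ℝ] Plane) 1 := by simp
  rcases lt_trichotomy r s with h | h | h
  · left
    have := hinj.sbtw_map_iff.2 (Sbtw.of_lt_of_lt h hs)
    rwa [← e] at this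
  · exact absurd (by rw [h]) hpq
  · right
    have := hinj.sbtw_map_iff.2 (Sbtw.of_lt_of_lt h hr)
    rwa [← e] at this

theorem sbtw_left_or_right_of_wbtw {a b p q : Plane} (hp : Wbtw ℝ a p b) (hq : Wbtw ℝ a q b)
    (hpq : p ≠ q) (hqa : q ≠ a) (hqb : q ≠ b) : Sbtw ℝ p q a ∨ Sbtw ℝ p q b := by
  rcases eq_or_ne p b with rfl | hpb
  · exact Or.inl ⟨hq.symm, hqb, hqa⟩
  rcases sbtw_or_sbtw_of_wbtw hp hq hpq hpb hqb with h | h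
  · exact Or.inr h
  · exact Or.inl ⟨(hq.trans_right_left h.wbtw).symm, hpq.symm, hqa⟩

section Polygon

variable {n : ℕ} {P : Polygon Plane n} {G : Finset Plane}

open Classical in
/-- The guards on the closed edge `i`. -/
noncomputable def edgeGuards (P : Polygon Plane n) (G : Finset Plane) (i : Fin n) : Finset Plane :=
  G.filter fun g => Wbtw ℝ (P i) g (P (finRotate n i))

theorem mem_edgeGuards {i : Fin n} {g : Plane} :
    g ∈ edgeGuards P G i ↔ g ∈ G ∧ Wbtw ℝ (P i) g (P (finRotate n i)) := by
  simp [edgeGuards]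

theorem left_mem_edgeGuards {i : Fin n} : P i ∈ edgeGuards P G i ↔ P i ∈ G := by
  simp [mem_edgeGuards]

theorem right_mem_edgeGuards {i : Fin n} :
    P (finRotate n i) ∈ edgeGuards P G i ↔ P (finRotate n i) ∈ G := by
  simp [mem_edgeGuards]

theorem mem_boundaryGuards_iff {g : Plane} :
    g ∈ boundaryGuards P G ↔ ∃ i, g ∈ edgeGuards P G i := by
  simp only [boundaryGuards, Set.mem_ofPred_eq, mem_boundary_iff, mem_edgeGuards, exists_and_left]

/-- Of three guards on an edge in this order, the third is an endpoint of the edge. -/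
theorem eq_or_eq_of_sbtw_edgeGuards (hdark : AtMostOneDark (region P) G) {i : Fin n}
    {p q r : Plane} (hp : p ∈ edgeGuards P G i) (hq : q ∈ edgeGuards P G i)
    (hr : r ∈ edgeGuards P G i) (h : Sbtw ℝ p q r) : r = P i ∨ r = P (finRotate n i) := by
  rw [mem_edgeGuards] at hp hq hr
  by_contra! hc
  rcases sbtw_left_or_right_of_wbtw hq.2 hr.2 h.ne_right hc.1 hc.2 with h' | h'
  · exact hdark.false_of_sbtw hp.1 hq.1 hr.1 (vertex_mem_region P _) h h'
  · exact hdark.false_of_sbtw hp.1 hq.1 hr.1 (vertex_mem_region P _) h h'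

/-- Three guards on an edge include both endpoints. -/
theorem endpoints_mem_of_edgeGuards (hdark : AtMostOneDark (region P) G) {i : Fin n}
    {p q r : Plane} (hp : p ∈ edgeGuards P G i) (hq : q ∈ edgeGuards P G i)
    (hr : r ∈ edgeGuards P G i) (hpq : p ≠ q) (hpr : p ≠ r) (hqr : q ≠ r) :
    (P i = p ∨ P i = q ∨ P i = r) ∧
      (P (finRotate n i) = p ∨ P (finRotate n i) = q ∨ P (finRotate n i) = r) := by
  have key : ∀ {p q r : Plane}, p ∈ edgeGuards P G i → q ∈ edgeGuards P G i →
      r ∈ edgeGuards P G i → Sbtw ℝ p q r →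
      (P i = p ∧ P (finRotate n i) = r) ∨ (P i = r ∧ P (finRotate n i) = p) := by
    intro p q r hp hq hr h
    have h1 := eq_or_eq_of_sbtw_edgeGuards hdark hp hq hr h
    have h2 := eq_or_eq_of_sbtw_edgeGuards hdark hr hq hp h.symm
    rcases h1 with h1 | h1 <;> rcases h2 with h2 | h2
    · exact absurd (h2.trans h1.symm) h.left_ne_right
    · exact Or.inr ⟨h1.symm, h2.symm⟩
    · exact Or.inl ⟨h2.symm, h1.symm⟩
    · exact absurd (h2.trans h1.symm) h.left_ne_right
  have hcol : Collinear ℝ ({p, q, r} : Set Plane) :=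
    collinear_triple_of_mem_affineSpan_pair (mem_edgeGuards.1 hp).2.mem_affineSpan
      (mem_edgeGuards.1 hq).2.mem_affineSpan (mem_edgeGuards.1 hr).2.mem_affineSpan
  rcases hcol.wbtw_or_wbtw_or_wbtw with h | h | h
  · have := key hp hq hr ⟨h, hpq.symm, hqr⟩
    tauto
  · have := key hq hr hp ⟨h, hqr.symm, hpr.symm⟩
    tauto
  · have := key hr hp hq ⟨h, hpr, hpq⟩
    tauto

open Classical in
/-- The guards in the relative interior of the edge `i`. -/
noncomputable def innerEdgeGuards (P : Polygon Plane n) (G : Finset Plane) (i : Fin n) :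
    Finset Plane :=
  ((edgeGuards P G i).erase (P i)).erase (P (finRotate n i))

theorem mem_innerEdgeGuards {i : Fin n} {g : Plane} : g ∈ innerEdgeGuards P G i ↔
    g ≠ P (finRotate n i) ∧ g ≠ P i ∧ g ∈ edgeGuards P G i := by
  classical
  simp [innerEdgeGuards]

theorem card_innerEdgeGuards_le (hdark : AtMostOneDark (region P) G) (i : Fin n) :
    (innerEdgeGuards P G i).card ≤ 2 := by
  classical
  by_contra! hc
  obtain ⟨p, q, r, hp, hq, hr, hpq, hpr, hqr⟩ := Finset.two_lt_card_iff.1 hc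
  rw [mem_innerEdgeGuards] at hp hq hr
  have := endpoints_mem_of_edgeGuards hdark hp.2.2 hq.2.2 hr.2.2 hpq hpr hqr
  grind

theorem notMem_of_two_le_card (hP : IsConvexPolygon P) (hdark : AtMostOneDark (region P) G)
    (i : Fin n) (h : 2 ≤ (innerEdgeGuards P G i).card) :
    P i ∉ G ∧ P (finRotate n i) ∉ G := by
  classical
  obtain ⟨p, q, hp, hq, hpq⟩ := Finset.one_lt_card_iff.1 h
  rw [mem_innerEdgeGuards] at hp hq
  have hne := hP.edge_ne i
  constructor <;> intro hv
  · have := endpoints_mem_of_edgeGuards hdark hp.2.2 hq.2.2 (left_mem_edgeGuards.2 hv) hpq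
      hp.2.1 hq.2.1
    grind
  · have := endpoints_mem_of_edgeGuards hdark hp.2.2 hq.2.2 (right_mem_edgeGuards.2 hv) hpq
      hp.1 hq.1
    grind

open Classical in
theorem card_edgeGuards_erase_right (hP : IsConvexPolygon P) (i : Fin n) :
    ((edgeGuards P G i).erase (P (finRotate n i))).card =
      (innerEdgeGuards P G i).card + if P i ∈ G then 1 else 0 := by
  rw [innerEdgeGuards, Finset.erase_right_comm]
  have hmem : P i ∈ (edgeGuards P G i).erase (P (finRotate n i)) ↔ P i ∈ G := by
    rw [Finset.mem_erase, left_mem_edgeGuards, and_iff_right (hP.edge_ne i)]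
  split_ifs with h
  · exact (Finset.card_erase_add_one (hmem.2 h)).symm
  · rw [Finset.erase_eq_of_notMem (mt hmem.1 h)]; rfl

open Classical in
theorem card_edgeGuards_erase_left (hP : IsConvexPolygon P) (i : Fin n) :
    ((edgeGuards P G i).erase (P i)).card =
      (innerEdgeGuards P G i).card + if P (finRotate n i) ∈ G then 1 else 0 := by
  rw [innerEdgeGuards]
  have hmem : P (finRotate n i) ∈ (edgeGuards P G i).erase (P i) ↔ P (finRotate n i) ∈ G := by
    rw [Finset.mem_erase, right_mem_edgeGuards, and_iff_right (hP.edge_ne i).symm]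
  split_ifs with h
  · exact (Finset.card_erase_add_one (hmem.2 h)).symm
  · rw [Finset.erase_eq_of_notMem (mt hmem.1 h)]; rfl

theorem innerEdgeGuards_or (hshrunk : IsShrunken P G) (i : Fin n) :
    1 ≤ (innerEdgeGuards P G i).card ∨ (P i ∈ G ∧ P (finRotate n i) ∈ G) := by
  refine (hshrunk i).imp_left ?_
  rintro ⟨g, hg, hs⟩
  exact Finset.card_pos.2
    ⟨g, mem_innerEdgeGuards.2 ⟨hs.ne_right, hs.ne_left, mem_edgeGuards.2 ⟨hg, hs.wbtw⟩⟩⟩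

open Classical in
/-- The number of endpoints of an edge that are darkened by its guards. -/
theorem edge_count (hP : IsConvexPolygon P) (hdark : AtMostOneDark (region P) G)
    (hshrunk : IsShrunken P G) (i : Fin n) :
    (if 2 ≤ ((edgeGuards P G i).erase (P i)).card then 1 else 0) +
      (if 2 ≤ ((edgeGuards P G i).erase (P (finRotate n i))).card then 1 else 0) + 2 =
    2 * (innerEdgeGuards P G i).card +
      ((if P i ∈ G then 1 else 0) + if P (finRotate n i) ∈ G then 1 else 0) := by
  -- With $k$ inner guards: $k = 0$ forces both endpoints to be guards and darkens neither; for $k =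
  -- 1$ each endpoint guard darkens the opposite endpoint; $k = 2$ excludes endpoint guards and
  -- darkens both.
  rw [card_edgeGuards_erase_left hP, card_edgeGuards_erase_right hP]
  have h1 := card_innerEdgeGuards_le hdark i
  have h2 := notMem_of_two_le_card hP hdark i
  have h3 := innerEdgeGuards_or hshrunk i
  by_cases ha : P i ∈ G <;> by_cases hb : P (finRotate n i) ∈ G <;>
    simp only [ha, hb, not_true_eq_false, not_false_eq_true, and_true, and_false, or_false,
      if_true, if_false, and_self, imp_false] at h2 h3 ⊢ <;> split_ifs <;> omega

/-- A point lies on at most one half-open edge. -/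
theorem IsConvexPolygon.edge_eq_of_wbtw (hP : IsConvexPolygon P) {i j : Fin n} {g : Plane}
    (hi : Wbtw ℝ (P i) g (P (finRotate n i))) (hi' : g ≠ P (finRotate n i))
    (hj : Wbtw ℝ (P j) g (P (finRotate n j))) (hj' : g ≠ P (finRotate n j)) : i = j := by
  have key : ∀ {i j : Fin n}, Wbtw ℝ (P i) g (P (finRotate n i)) →
      Wbtw ℝ (P j) g (P (finRotate n j)) → g ≠ P (finRotate n j) →
      j = i ∨ j = finRotate n i := by
    intro i j hi hj hj'
    apply hP.eq_or_eq_of_cross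
    have h0 := cross_eq_zero_of_wbtw hi
    obtain ⟨r, ⟨hr0, hr1⟩, rfl⟩ := hj
    have hr : r < 1 := lt_of_le_of_ne hr1 (by rintro rfl; simp at hj')
    rw [cross_lineMap] at h0
    have h1 := hP.cross_vertex_nonneg i j
    have h2 := hP.cross_vertex_nonneg i (finRotate n j)
    nlinarith
  rcases key hi hj hj' with h | h
  · exact h.symm
  rcases key hj hi hi' with h' | h'
  · exact h'
  · rw [h] at h'
    exact absurd h'.symm (finRotate_finRotate_ne_self hP.1 i)

/-- The edges without their final endpoints partition the boundary. -/
theorem ncard_boundaryGuards (hP : IsConvexPolygon P) [DecidablePred fun i => P i ∈ G] :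
    (boundaryGuards P G).ncard =
      ∑ i, ((innerEdgeGuards P G i).card + if P i ∈ G then 1 else 0) := by
  classical
  have e : boundaryGuards P G = ((Finset.univ : Finset (Fin n)).biUnion fun i =>
      (edgeGuards P G i).erase (P (finRotate n i)) : Finset Plane) := by
    ext g
    simp only [mem_boundaryGuards_iff, Finset.coe_biUnion, Set.mem_iUnion, Finset.mem_coe,
      Finset.mem_univ, Finset.mem_erase, exists_prop, true_and]
    constructor
    · rintro ⟨i, hi⟩
      by_cases h : g = P (finRotate n i)
      · refine ⟨finRotate n i, ?_, ?_⟩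
        · rw [h]; exact hP.edge_ne _
        · rw [h] at hi ⊢
          exact left_mem_edgeGuards.2 (right_mem_edgeGuards.1 hi)
      · exact ⟨i, h, hi⟩
    · rintro ⟨i, -, hi⟩
      exact ⟨i, hi⟩
  rw [e, Set.ncard_coe_finset, Finset.card_biUnion]
  · exact Finset.sum_congr rfl fun i _ => by
      rw [card_edgeGuards_erase_right hP]; congr
  · intro i _ j _ hij
    refine Finset.disjoint_left.2 fun g hi hj => ?_
    rw [Finset.mem_erase, mem_edgeGuards] at hi hj
    exact hij (hP.edge_eq_of_wbtw hi.2.2 hi.1 hj.2.2 hj.1)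

/-! ### Darkened vertices and the count of boundary guards -/

/-- A darkened vertex is darkened from one of its two edges. -/
theorem exists_edge_of_mem_darkenedVertices (hP : IsConvexPolygon P)
    (hG : ∀ g ∈ G, g ∈ region P) {k : Fin n} (hk : k ∈ darkenedVertices P G) :
    ∃ j, (k = j ∨ k = finRotate n j) ∧ ∃ a ∈ edgeGuards P G j, ∃ b ∈ edgeGuards P G j,
      MutuallyVisible G a b ∧ Sbtw ℝ b a (P k) := by
  obtain ⟨a, ha, b, hb, hab, hs⟩ := hk
  replace hs : Sbtw ℝ b a (P k) := hs
  obtain ⟨j, hj⟩ := mem_boundaryGuards_iff.1 ha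
  have h := hP.wbtw_of_sbtw (hG b hb.1) (vertex_mem_region P k) hs (mem_edgeGuards.1 hj).2
  exact ⟨j, hP.eq_or_eq_of_wbtw h.2, a, hj, b, mem_edgeGuards.2 ⟨hb.1, h.1⟩, hab, hs⟩

open Classical in
/-- Two guards of an edge other than an endpoint of that edge darken it. -/
theorem exists_visible_of_two_le_card {j k : Fin n} (hk : k = j ∨ k = finRotate n j)
    (h : 2 ≤ ((edgeGuards P G j).erase (P k)).card) :
    ∃ a ∈ edgeGuards P G j, ∃ b ∈ edgeGuards P G j, MutuallyVisible G a b ∧ Sbtw ℝ b a (P k) := by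
  obtain ⟨p, q, hp, hq, hpq⟩ := Finset.one_lt_card_iff.1 h
  rw [Finset.mem_erase, mem_edgeGuards] at hp hq
  have hs : Sbtw ℝ p q (P k) ∨ Sbtw ℝ q p (P k) := by
    rcases hk with rfl | rfl
    · exact sbtw_or_sbtw_of_wbtw hp.2.2.symm hq.2.2.symm hpq hp.1 hq.1
    · exact sbtw_or_sbtw_of_wbtw hp.2.2 hq.2.2 hpq hp.1 hq.1
  have key : ∀ {p q : Plane}, p ∈ G → Wbtw ℝ (P j) p (P (finRotate n j)) → q ∈ G →
      Wbtw ℝ (P j) q (P (finRotate n j)) → Sbtw ℝ p q (P k) →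
      ∃ a ∈ edgeGuards P G j, ∃ b ∈ edgeGuards P G j,
        MutuallyVisible G a b ∧ Sbtw ℝ b a (P k) := by
    intro p q hp hpe hq hqe hs
    obtain ⟨b, hb, hw, hbs⟩ := exists_mutuallyVisible_sbtw hq hp hs
    refine ⟨q, mem_edgeGuards.2 ⟨hq, hqe⟩, b, mem_edgeGuards.2 ⟨hb.2.1, ?_⟩, hb, hbs⟩
    exact mem_segment_iff_wbtw.1 ((convex_segment _ _).segment_subset
      (mem_segment_iff_wbtw.2 hpe) (mem_segment_iff_wbtw.2 hqe) (mem_segment_iff_wbtw.2 hw))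
  rcases hs with hs | hs
  · exact key hp.2.1 hp.2.2 hq.2.1 hq.2.2 hs
  · exact key hq.2.1 hq.2.2 hp.2.1 hp.2.2 hs

open Classical in
theorem finRotate_mem_darkenedVertices_iff (hP : IsConvexPolygon P)
    (hG : ∀ g ∈ G, g ∈ region P) (j : Fin n) :
    finRotate n j ∈ darkenedVertices P G ↔
      2 ≤ ((edgeGuards P G (finRotate n j)).erase (P (finRotate n j))).card ∨
      2 ≤ ((edgeGuards P G j).erase (P (finRotate n j))).card := by
  constructor
  · intro h
    obtain ⟨i, hi, a, ha, b, hb, hab, hs⟩ := exists_edge_of_mem_darkenedVertices hP hG h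
    have h2 : 2 ≤ ((edgeGuards P G i).erase (P (finRotate n j))).card :=
      Finset.one_lt_card_iff.2 ⟨a, b, Finset.mem_erase.2 ⟨hs.ne_right, ha⟩,
        Finset.mem_erase.2 ⟨hs.left_ne_right, hb⟩, hab.2.2.1⟩
    rcases hi with hi | hi
    · rw [← hi] at h2; exact Or.inl h2
    · rw [← (finRotate n).injective hi] at h2; exact Or.inr h2
  · rintro (h | h)
    · obtain ⟨a, ha, b, hb, hab, hs⟩ := exists_visible_of_two_le_card (Or.inl rfl) h
      exact ⟨a, mem_boundaryGuards_iff.2 ⟨_, ha⟩, b, mem_boundaryGuards_iff.2 ⟨_, hb⟩, hab, hs⟩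
    · obtain ⟨a, ha, b, hb, hab, hs⟩ := exists_visible_of_two_le_card (Or.inr rfl) h
      exact ⟨a, mem_boundaryGuards_iff.2 ⟨_, ha⟩, b, mem_boundaryGuards_iff.2 ⟨_, hb⟩, hab, hs⟩

open Classical in
/-- A vertex is not darkened from both of its edges. -/
theorem not_two_le_card_both (hP : IsConvexPolygon P) (hdark : AtMostOneDark (region P) G)
    (j : Fin n) (h : 2 ≤ ((edgeGuards P G (finRotate n j)).erase (P (finRotate n j))).card) :
    ¬ 2 ≤ ((edgeGuards P G j).erase (P (finRotate n j))).card := by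
  intro h'
  obtain ⟨a, ha, b, -, hab, hs⟩ := exists_visible_of_two_le_card (Or.inl rfl) h
  obtain ⟨a', ha', b', -, hab', hs'⟩ := exists_visible_of_two_le_card (Or.inr rfl) h'
  have e := hdark _ (vertex_mem_region P _) a b a' b' hab hab' hs hs'
  subst e
  -- A common root lies on both edges, so it is the vertex itself, which the open ray omits.
  exact hs.ne_right (eq_of_cross_eq
    (hP.2 j _ (finRotate_finRotate_ne_self hP.1 j) (finRotate_ne_self hP.1 _)).ne'
    (by rw [cross_self_left]; exact cross_eq_zero_of_wbtw (mem_edgeGuards.1 ha).2)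
    (by rw [cross_self_right]; exact cross_eq_zero_of_wbtw (mem_edgeGuards.1 ha').2))

open Classical in
-- Each darkened vertex is charged to exactly one of its two edges; shifting the index regroups the
-- sum over vertices by edges.
theorem ncard_darkenedVertices (hP : IsConvexPolygon P) (hG : ∀ g ∈ G, g ∈ region P)
    (hdark : AtMostOneDark (region P) G) :
    (darkenedVertices P G).ncard =
      ∑ i, ((if 2 ≤ ((edgeGuards P G i).erase (P i)).card then 1 else 0) +
        if 2 ≤ ((edgeGuards P G i).erase (P (finRotate n i))).card then 1 else 0) := by
  have e : (darkenedVertices P G).ncard =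
      ∑ k, if k ∈ darkenedVertices P G then 1 else 0 := by
    rw [← Finset.card_filter, ← Set.ncard_coe_finset]
    simp
  rw [e, ← Equiv.sum_comp (finRotate n), Finset.sum_add_distrib,
    ← Equiv.sum_comp (finRotate n) fun i =>
      if 2 ≤ ((edgeGuards P G i).erase (P i)).card then 1 else 0, ← Finset.sum_add_distrib]
  refine Finset.sum_congr rfl fun j _ => ?_
  have h1 := finRotate_mem_darkenedVertices_iff hP hG j
  have h2 := not_two_le_card_both hP hdark j
  split_ifs <;> tauto

/-- Summing `edge_count`, every vertex guard appears as an endpoint of two edges, so the right side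
is twice the number of boundary guards. -/
theorem two_mul_ncard_boundaryGuards (hP : IsConvexPolygon P) (hG : ∀ g ∈ G, g ∈ region P)
    (hdark : AtMostOneDark (region P) G) (hshrunk : IsShrunken P G) :
    2 * (boundaryGuards P G).ncard = 2 * n + (darkenedVertices P G).ncard := by
  classical
  have h := Finset.sum_congr rfl fun i (_ : i ∈ (Finset.univ : Finset (Fin n))) =>
    edge_count hP hdark hshrunk i
  have hrot := Equiv.sum_comp (finRotate n) fun i => if P i ∈ G then 1 else 0
  rw [Finset.sum_add_distrib, ← ncard_darkenedVertices hP hG hdark, Finset.sum_add_distrib,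
    ← Finset.mul_sum, Finset.sum_add_distrib, hrot] at h
  rw [ncard_boundaryGuards hP, Finset.sum_add_distrib]
  simp only [Finset.sum_const, Finset.card_univ, Fintype.card_fin, smul_eq_mul] at h
  omega

/-! ### Charging interior corners to undarkened vertices -/

theorem exists_edgeGuard (hshrunk : IsShrunken P G) (i : Fin n) : ∃ g, g ∈ edgeGuards P G i := by
  rcases hshrunk i with ⟨g, hg, hs⟩ | ⟨h, -⟩
  · exact ⟨g, mem_edgeGuards.2 ⟨hg, hs.wbtw⟩⟩
  · exact ⟨_, left_mem_edgeGuards.2 h⟩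

/-- The inner corner `x` belongs to the vertex `finRotate n i`. -/
def IsCornerAt (P : Polygon Plane n) (G : Finset Plane) (i : Fin n) (x : Plane) : Prop :=
  P (finRotate n i) ∉ G ∧
    IsStrictMin (crossForm (P (finRotate n i)) (P (finRotate n (finRotate n i))))
      (crossForm (P i) (P (finRotate n i))) G x

theorem eq_of_isCornerAt (hP : IsConvexPolygon P) (hG : ∀ g ∈ G, g ∈ region P)
    (hdark : AtMostOneDark (region P) G) (hshrunk : IsShrunken P G) {i : Fin n} {x y : Plane}
    (hx : x ∈ interiorCorners P G) (hy : y ∈ interiorCorners P G) (hxi : IsCornerAt P G i x)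
    (hyi : IsCornerAt P G i y) : x = y := by
  obtain ⟨a, ha⟩ := exists_edgeGuard hshrunk i
  obtain ⟨b, hb⟩ := exists_edgeGuard hshrunk (finRotate n i)
  rw [mem_edgeGuards] at ha hb
  have hw := hP.isWedge hG hdark i ha.1 hb.1 ha.2 hb.2 (fun e => hxi.1 (e ▸ ha.1))
    (fun e => hxi.1 (e ▸ hb.1))
  exact hw.eq_of_isStrictMin hx.1 (hP.cross_pos_of_mem_interior _ hx.2.2)
    (hP.cross_pos_of_mem_interior _ hx.2.2) hxi.2 hy.1 (hP.cross_pos_of_mem_interior _ hy.2.2)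
    (hP.cross_pos_of_mem_interior _ hy.2.2) hyi.2

/-- The root of the darkening ray serves as the wedge guard on its edge; the other edge supplies any
guard. The two possible edges are exchanged by swapping coordinates. -/
theorem notMem_darkenedVertices_of_isCornerAt (hP : IsConvexPolygon P)
    (hG : ∀ g ∈ G, g ∈ region P) (hdark : AtMostOneDark (region P) G) (hshrunk : IsShrunken P G)
    {i : Fin n} {x : Plane} (hx : x ∈ interiorCorners P G) (hxi : IsCornerAt P G i x) :
    finRotate n i ∉ darkenedVertices P G := by
  intro hk
  obtain ⟨j, hj, a', ha', b', -, hab, hs⟩ := exists_edge_of_mem_darkenedVertices hP hG hk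
  have hS := hP.cross_pos_of_mem_interior (finRotate n i) hx.2.2
  have hT := hP.cross_pos_of_mem_interior i hx.2.2
  rw [mem_edgeGuards] at ha'
  rcases hj with rfl | hj
  · obtain ⟨a, ha⟩ := exists_edgeGuard hshrunk i
    rw [mem_edgeGuards] at ha
    have hw := hP.isWedge hG hdark i ha.1 ha'.1 ha.2 ha'.2 (fun e => hxi.1 (e ▸ ha.1)) hs.ne_right
    exact hw.swap.false_of_sbtw hx.1 hT hS hxi.2.swap hab hs
  · obtain rfl := (finRotate n).injective hj
    obtain ⟨b, hb⟩ := exists_edgeGuard hshrunk (finRotate n i)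
    rw [mem_edgeGuards] at hb
    have hw := hP.isWedge hG hdark i ha'.1 hb.1 ha'.2 hb.2 hs.ne_right (fun e => hxi.1 (e ▸ hb.1))
    exact hw.false_of_sbtw hx.1 hS hT hxi.2 hab hs

theorem ncard_interiorCorners_add_le (hP : IsConvexPolygon P) (hG : ∀ g ∈ G, g ∈ region P)
    (hdark : AtMostOneDark (region P) G) (hshrunk : IsShrunken P G) :
    (interiorCorners P G).ncard + (darkenedVertices P G).ncard ≤ n := by
  have hex : ∀ x ∈ interiorCorners P G, ∃ i, IsCornerAt P G i x :=
    fun x hx => hP.exists_isStrictMin hx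
  have : Nonempty (Fin n) := ⟨⟨0, by have := hP.1; omega⟩⟩
  choose! φ hφ using hex
  have h : (interiorCorners P G).ncard ≤ (darkenedVertices P G)ᶜ.ncard := by
    refine Set.ncard_le_ncard_of_injOn (fun x => finRotate n (φ x)) (fun x hx =>
      notMem_darkenedVertices_of_isCornerAt hP hG hdark hshrunk hx (hφ x hx)) ?_ (Set.toFinite _)
    intro x hx y hy hxy
    have e : φ x = φ y := (finRotate n).injective hxy
    exact eq_of_isCornerAt hP hG hdark hshrunk hx hy (hφ x hx) (e ▸ hφ y hy)
  have h2 := Set.ncard_add_ncard_compl (darkenedVertices P G)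
  rw [Nat.card_eq_fintype_card, Fintype.card_fin] at h2
  omega

end Polygon

end DarkRays

theorem mainTheorem4 {n : ℕ} (P : Polygon DarkRays.Plane n) (hP : DarkRays.IsConvexPolygon P)
    (G : Finset DarkRays.Plane) (hG : ∀ g ∈ G, g ∈ DarkRays.region P)
    (hdark : ∀ x ∈ DarkRays.region P, ¬ DarkRays.IsDark 2 G x)
    (hshrunk : DarkRays.IsShrunken P G) :
    (DarkRays.starGuards P G).ncard ≤ 2 * n ∧
    ((DarkRays.boundaryGuards P G).ncard : ℚ) =
      (n : ℚ) + ((DarkRays.darkenedVertices P G).ncard : ℚ) / 2 ∧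
    ((DarkRays.interiorCorners P G).ncard : ℤ) ≤
      (n : ℤ) - ((DarkRays.darkenedVertices P G).ncard : ℤ) := by
  have hd := DarkRays.atMostOneDark_of_not_isDark hdark
  have h1 := DarkRays.two_mul_ncard_boundaryGuards hP hG hd hshrunk
  have h2 := DarkRays.ncard_interiorCorners_add_le hP hG hd hshrunk
  have h3 : (DarkRays.starGuards P G).ncard ≤ _ := Set.ncard_union_le _ _
  -- The first bound combines $2g^P = 2n + d$ with $c + d \le n$, giving $g^* \le 2n - d/2$.
  refine ⟨by omega, ?_, by omega⟩
  have h1' : (2 : ℚ) * (DarkRays.boundaryGuards P G).ncard =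
      2 * n + (DarkRays.darkenedVertices P G).ncard := by exact_mod_cast h1
  linarith
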